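/- Let $E_8$ be the $E_8$ root lattice with its symmetric bilinear form $(\cdot,\cdot)$, and let $O(E_8)$ be its isometry group. Call a vector $x\in E_8$ with $(x,x)=2$ a root, and call $h\in O(E_8)$ rootless if the sublattice $(h-1)E_8=\{hx-x : x\in E_8\}$ contains no roots. Let $h\in O(E_8)$ have order $2$, and let $L^-(h)=\{x\in E_8 : hx=-x\}$ be its $(-1)$-eigenlattice, with the form restricted from $E_8$. Then $h$ is rootless if and only if $L^-(h)$ is isometric to one of the root lattices $D_4$, $D_6$, $E_7$ or $E_8$. -/

import Mathlib

/-!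
An integral lattice is a finitely generated free `ℤ`-module together with a symmetric
`ℤ`-valued bilinear form `B`; the norm of `x` is `B x x`.
-/

namespace IntegralLattice

/-- Isometry of lattices: a `ℤ`-linear bijection that carries one form to the other. -/
def IsIsometric {L L' : Type*} [AddCommGroup L] [AddCommGroup L']
    (B : LinearMap.BilinForm ℤ L) (B' : LinearMap.BilinForm ℤ L') : Prop :=
  ∃ e : L ≃ₗ[ℤ] L', ∀ x y : L, B' (e x) (e y) = B x y

/-- The isometry group `O(L)` of a lattice `L` with form `B`. -/
def isometryGroup {L : Type*} [AddCommGroup L] (B : LinearMap.BilinForm ℤ L) :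
    Subgroup (L ≃ₗ[ℤ] L) where
  carrier := {g | ∀ x y : L, B (g x) (g y) = B x y}
  one_mem' := fun _ _ => rfl
  mul_mem' := fun {g k} hg hk x y => (hg (k x) (k y)).trans (hk x y)
  inv_mem' := fun {g} hg x y => by
    have h := hg (g⁻¹ x) (g⁻¹ y)
    rw [← LinearEquiv.mul_apply, ← LinearEquiv.mul_apply, mul_inv_cancel] at h
    exact h.symm

/-- A root is a lattice vector of norm `2`. -/
def IsRoot {L : Type*} [AddCommGroup L] (B : LinearMap.BilinForm ℤ L) (x : L) : Prop :=
  B x x = 2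

/-- The sublattice `(h - 1)L`. -/
def subOneImage {L : Type*} [AddCommGroup L] (h : L ≃ₗ[ℤ] L) : Submodule ℤ L :=
  LinearMap.range ((h : L →ₗ[ℤ] L) - LinearMap.id)

/-- An isometry `h` is rootless if `(h - 1)L` contains no roots. -/
def IsRootless {L : Type*} [AddCommGroup L] {B : LinearMap.BilinForm ℤ L}
    (h : isometryGroup B) : Prop :=
  ∀ x ∈ subOneImage (h : L ≃ₗ[ℤ] L), ¬ IsRoot B x

/-- The `(-1)`-eigenlattice `{x ∈ L | h x = -x}`. -/
def negEigenlattice {L : Type*} [AddCommGroup L] (h : L ≃ₗ[ℤ] L) : Submodule ℤ L :=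
  Module.End.eigenspace (h : L →ₗ[ℤ] L) (-1)

/-- The form on `ℤⁿ` with Gram matrix `C`. If `C` is the Cartan matrix of a simply laced Dynkin
diagram, then this is the root lattice of that diagram, with the simple roots as basis. -/
def gramForm {n : ℕ} (C : Matrix (Fin n) (Fin n) ℤ) : LinearMap.BilinForm ℤ (Fin n → ℤ) :=
  Matrix.toBilin' C

/-- The `D₄`-lattice. -/
def formD4 : LinearMap.BilinForm ℤ (Fin 4 → ℤ) := gramForm (CartanMatrix.D 4)

/-- The `D₆`-lattice. -/
def formD6 : LinearMap.BilinForm ℤ (Fin 6 → ℤ) := gramForm (CartanMatrix.D 6)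

/-- The `E₇`-lattice. -/
def formE7 : LinearMap.BilinForm ℤ (Fin 7 → ℤ) := gramForm CartanMatrix.E₇

/-- The `E₈`-lattice. -/
def formE8 : LinearMap.BilinForm ℤ (Fin 8 → ℤ) := gramForm CartanMatrix.E₈

end IntegralLattice

/-! An involution `h` is the product of the reflections in a set `R` of pairwise orthogonal roots,
so `(h - 1) x = -∑ (r, x) r` (`exists_isOrthogonalRootSet`). This rests on the fact that a
nontrivial involutive isometry negates some root: otherwise it fixes a vector orthogonal to no root,
and an involutive isometry fixing such a vector is trivial (`eq_self_of_fixes_regular`).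

If `h` is rootless, no `r ∈ R` has the form `∑ (s, x) s`. By duality modulo 2 and unimodularity,
each `r` then lies in a subset of `R` whose sum is in `2E₈` (`IsOrthogonalRootSet.exists_half_sum`).
These subsets form a binary code on `R` with all weights divisible by four and no coordinate
identically zero. If `|R| = 8`, then `h = -1`. Otherwise the code has length 4, 6 or 7 and contains
explicit words (`doublyEven_code_cases`); `R` and the half sums over these words generate `L⁻`,
which is thus `D₄`, `D₆` or `E₇`.

Conversely, `(h - 1) x` lies in `L⁻` and has even pairing with all of `L⁻`. In each of the four
lattices, a vector with even pairings cannot have norm 2, by a congruence. -/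

namespace IntegralLattice

/-! ### The form of `E₈`: evenness and positive definiteness -/

theorem formE8_apply (x y : Fin 8 → ℤ) :
    formE8 x y = ∑ i, ∑ j, x i * CartanMatrix.E₈ i j * y j :=
  Matrix.toBilin'_apply _ _ _

theorem formE8_comm (x y : Fin 8 → ℤ) : formE8 x y = formE8 y x := by
  rw [formE8_apply, formE8_apply, Finset.sum_comm]
  refine Finset.sum_congr rfl fun i _ => Finset.sum_congr rfl fun j _ => ?_
  rw [← CartanMatrix.E₈_isSymm.apply i j]
  ring

theorem formE8_self (x : Fin 8 → ℤ) :
    formE8 x x = 2 * (x 0 ^ 2 + x 1 ^ 2 + x 2 ^ 2 + x 3 ^ 2 + x 4 ^ 2 + x 5 ^ 2 + x 6 ^ 2 + x 7 ^ 2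
      - x 0 * x 2 - x 1 * x 3 - x 2 * x 3 - x 3 * x 4 - x 4 * x 5 - x 5 * x 6 - x 6 * x 7) := by
  rw [formE8_apply]
  simp [Fin.sum_univ_succ, CartanMatrix.E₈]
  ring

theorem even_formE8_self (x : Fin 8 → ℤ) : Even (formE8 x x) := by
  rw [formE8_self]
  exact even_two_mul _

/-- Completing the square along the Dynkin diagram; the factor 60 clears the denominators. Positive
definiteness is read off from this. -/
theorem sixty_mul_formE8_self (x : Fin 8 → ℤ) :
    60 * formE8 x x = 30 * (2 * x 0 - x 2) ^ 2 + 30 * (2 * x 1 - x 3) ^ 2 +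
      10 * (3 * x 2 - 2 * x 3) ^ 2 + 2 * (5 * x 3 - 6 * x 4) ^ 2 + 3 * (4 * x 4 - 5 * x 5) ^ 2 +
      5 * (3 * x 5 - 4 * x 6) ^ 2 + 10 * (2 * x 6 - 3 * x 7) ^ 2 + 30 * x 7 ^ 2 := by
  rw [formE8_self]
  ring

theorem formE8_self_nonneg (x : Fin 8 → ℤ) : 0 ≤ formE8 x x := by
  have h := sixty_mul_formE8_self x
  have : 0 ≤ 60 * formE8 x x := by rw [h]; positivity
  linarith

theorem eq_zero_of_formE8_self_eq_zero {x : Fin 8 → ℤ} (hx : formE8 x x = 0) : x = 0 := by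
  have h := sixty_mul_formE8_self x
  rw [hx] at h
  have h0 := sq_nonneg (2 * x 0 - x 2)
  have h1 := sq_nonneg (2 * x 1 - x 3)
  have h2 := sq_nonneg (3 * x 2 - 2 * x 3)
  have h3 := sq_nonneg (5 * x 3 - 6 * x 4)
  have h4 := sq_nonneg (4 * x 4 - 5 * x 5)
  have h5 := sq_nonneg (3 * x 5 - 4 * x 6)
  have h6 := sq_nonneg (2 * x 6 - 3 * x 7)
  have h7 := sq_nonneg (x 7)
  have k0 : 2 * x 0 - x 2 = 0 := pow_eq_zero_iff two_ne_zero |>.1 (by linarith)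
  have k1 : 2 * x 1 - x 3 = 0 := pow_eq_zero_iff two_ne_zero |>.1 (by linarith)
  have k2 : 3 * x 2 - 2 * x 3 = 0 := pow_eq_zero_iff two_ne_zero |>.1 (by linarith)
  have k3 : 5 * x 3 - 6 * x 4 = 0 := pow_eq_zero_iff two_ne_zero |>.1 (by linarith)
  have k4 : 4 * x 4 - 5 * x 5 = 0 := pow_eq_zero_iff two_ne_zero |>.1 (by linarith)
  have k5 : 3 * x 5 - 4 * x 6 = 0 := pow_eq_zero_iff two_ne_zero |>.1 (by linarith)
  have k6 : 2 * x 6 - 3 * x 7 = 0 := pow_eq_zero_iff two_ne_zero |>.1 (by linarith)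
  have k7 : x 7 = 0 := pow_eq_zero_iff two_ne_zero |>.1 (by linarith)
  ext i
  fin_cases i <;> simp only [Pi.zero_apply] <;> dsimp <;> omega

theorem two_le_formE8_self {x : Fin 8 → ℤ} (hx : x ≠ 0) : 2 ≤ formE8 x x := by
  have h0 := formE8_self_nonneg x
  have h1 : formE8 x x ≠ 0 := fun h => hx (eq_zero_of_formE8_self_eq_zero h)
  obtain ⟨k, hk⟩ := even_formE8_self x
  omega

/-! ### Simple roots, fundamental weights and unimodularity -/

/-- The `i`-th simple root of `E₈`. -/
def simpleRoot (i : Fin 8) : Fin 8 → ℤ := Pi.single i 1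

theorem isRoot_simpleRoot (i : Fin 8) : formE8 (simpleRoot i) (simpleRoot i) = 2 := by
  simp [formE8, gramForm, simpleRoot]

theorem eq_sum_simpleRoot (x : Fin 8 → ℤ) : x = ∑ i, x i • simpleRoot i := by
  simp only [simpleRoot, ← Pi.single_smul, smul_eq_mul, mul_one]
  exact (Finset.univ_sum_single x).symm

theorem formE8_eq_sum_simpleRoot (v x : Fin 8 → ℤ) :
    formE8 v x = ∑ i, x i * formE8 v (simpleRoot i) := by
  conv_lhs => rw [eq_sum_simpleRoot x]
  simp only [map_sum, map_smul, smul_eq_mul]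

/-- The inverse of the Cartan matrix of type `E₈`. -/
def inverseCartanE8 : Matrix (Fin 8) (Fin 8) ℤ :=
  !![4, 5, 7, 10, 8, 6, 4, 2;
     5, 8, 10, 15, 12, 9, 6, 3;
     7, 10, 14, 20, 16, 12, 8, 4;
     10, 15, 20, 30, 24, 18, 12, 6;
     8, 12, 16, 24, 20, 15, 10, 5;
     6, 9, 12, 18, 15, 12, 8, 4;
     4, 6, 8, 12, 10, 8, 6, 3;
     2, 3, 4, 6, 5, 4, 3, 2]

theorem inverseCartanE8_mul : inverseCartanE8 * CartanMatrix.E₈ = 1 := by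
  decide +kernel

/-- The `i`-th fundamental weight of `E₈`, dual to the `i`-th simple root. -/
def fundamentalWeight (i : Fin 8) : Fin 8 → ℤ := inverseCartanE8 i

theorem formE8_fundamentalWeight (i : Fin 8) (x : Fin 8 → ℤ) :
    formE8 (fundamentalWeight i) x = x i := by
  have h : Matrix.vecMul (fundamentalWeight i) CartanMatrix.E₈ = Pi.single i 1 := by
    have := congrFun inverseCartanE8_mul i
    rw [Matrix.mul_apply_eq_vecMul] at this
    rw [fundamentalWeight, this]
    ext j
    simp [Matrix.one_apply, Pi.single_apply, eq_comm]
  rw [formE8, gramForm, Matrix.toBilin'_apply', Matrix.dotProduct_mulVec, h]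
  simp

theorem formE8_fundamentalWeight_self (i : Fin 8) :
    formE8 (fundamentalWeight i) (fundamentalWeight i) = ![4, 8, 14, 30, 20, 12, 6, 2] i := by
  rw [formE8_fundamentalWeight]
  revert i
  decide

theorem eq_of_fundamentalWeight_norm_eq {i j : Fin 8}
    (h : formE8 (fundamentalWeight i) (fundamentalWeight i) =
      formE8 (fundamentalWeight j) (fundamentalWeight j)) : i = j := by
  rw [formE8_fundamentalWeight_self, formE8_fundamentalWeight_self] at h
  revert i j
  decide

theorem eq_of_formE8_eq {x y : Fin 8 → ℤ} (h : ∀ z, formE8 x z = formE8 y z) : x = y := by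
  ext i
  rw [← formE8_fundamentalWeight i x, ← formE8_fundamentalWeight i y, formE8_comm _ x,
    formE8_comm _ y, h]

/-- The Weyl vector of `E₈`, the sum of the fundamental weights. -/
def weylVector : Fin 8 → ℤ := ∑ i, fundamentalWeight i

theorem formE8_weylVector (x : Fin 8 → ℤ) : formE8 weylVector x = ∑ i, x i := by
  simp [weylVector, formE8_fundamentalWeight]

theorem finite_roots : {x : Fin 8 → ℤ | formE8 x x = 2}.Finite := by
  -- Fundamental weights have norm at most 30, so `(x ± ω, x ± ω) ≥ 0` bounds each coordinate `(ω,
  -- x)` by `(2 + 30) / 2 = 16`.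
  refine (Set.finite_Icc (fun _ : Fin 8 => (-16 : ℤ)) fun _ => 16).subset fun x hx => ?_
  have hx : formE8 x x = 2 := hx
  have hw (i : Fin 8) : formE8 (fundamentalWeight i) (fundamentalWeight i) ≤ 30 := by
    rw [formE8_fundamentalWeight_self]
    revert i
    decide
  constructor <;> intro i <;> dsimp only
  · have h := formE8_self_nonneg (x + fundamentalWeight i)
    simp only [map_add, LinearMap.add_apply, formE8_comm x (fundamentalWeight i), hx] at h
    have := hw i
    rw [formE8_fundamentalWeight i x] at h
    linarith
  · have h := formE8_self_nonneg (x - fundamentalWeight i)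
    simp only [map_sub, LinearMap.sub_apply, formE8_comm x (fundamentalWeight i), hx] at h
    have := hw i
    rw [formE8_fundamentalWeight i x] at h
    linarith

/-- The positive and negative parts have disjoint supports, so their pairing involves only
off-diagonal Cartan entries and is nonpositive. If both were nonzero, the norm would be at least `2
+ 2`. -/
theorem root_nonneg_or_nonpos {x : Fin 8 → ℤ} (hx : formE8 x x = 2) :
    (∀ i, 0 ≤ x i) ∨ ∀ i, x i ≤ 0 := by
  set p : Fin 8 → ℤ := fun i => max (x i) 0 with hp
  set n : Fin 8 → ℤ := fun i => max (-x i) 0 with hn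
  have hxpn : x = p - n := by
    ext i
    simp only [hp, hn, Pi.sub_apply]
    omega
  have hB : formE8 p n ≤ 0 := by
    rw [formE8_apply]
    refine Finset.sum_nonpos fun i _ => Finset.sum_nonpos fun j _ => ?_
    rcases eq_or_ne i j with rfl | hij
    · have : p i * n i = 0 := by
        rcases le_total (x i) 0 with h | h <;> simp [hp, hn, h]
      rw [mul_right_comm, this, zero_mul]
    · have h1 : 0 ≤ p i := le_max_right _ _
      have h2 : 0 ≤ n j := le_max_right _ _
      exact mul_nonpos_of_nonpos_of_nonneg
        (mul_nonpos_of_nonneg_of_nonpos h1 (CartanMatrix.E₈_off_diag_nonpos i j hij)) h2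
  by_cases hp0 : p = 0
  · right
    intro i
    have := congrFun hp0 i
    simp only [hp, Pi.zero_apply] at this
    omega
  by_cases hn0 : n = 0
  · left
    intro i
    have := congrFun hn0 i
    simp only [hn, Pi.zero_apply] at this
    omega
  have h1 := two_le_formE8_self hp0
  have h2 := two_le_formE8_self hn0
  rw [hxpn] at hx
  simp only [map_sub, LinearMap.sub_apply, formE8_comm n p] at hx
  linarith

/-! ### Reflections and involutions fixing a regular vector -/

/-- The reflection `x ↦ x - (r, x) r` in a root `r`. -/
def rootReflection (r : Fin 8 → ℤ) : (Fin 8 → ℤ) →ₗ[ℤ] (Fin 8 → ℤ) :=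
  LinearMap.id - (formE8 r).smulRight r

theorem rootReflection_apply (r x : Fin 8 → ℤ) :
    rootReflection r x = x - formE8 r x • r := rfl

theorem rootReflection_rootReflection {r : Fin 8 → ℤ} (hr : formE8 r r = 2) (x : Fin 8 → ℤ) :
    rootReflection r (rootReflection r x) = x := by
  simp only [rootReflection_apply, map_sub, map_smul, hr]
  module

theorem formE8_rootReflection {r : Fin 8 → ℤ} (hr : formE8 r r = 2) (x y : Fin 8 → ℤ) :
    formE8 (rootReflection r x) (rootReflection r y) = formE8 x y := by
  simp only [rootReflection_apply, map_sub, map_smul, LinearMap.sub_apply, LinearMap.smul_apply,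
    hr, smul_eq_mul, formE8_comm x r]
  ring

theorem exists_simpleRoot_eq_of_nonneg {f : (Fin 8 → ℤ) →ₗ[ℤ] (Fin 8 → ℤ)}
    (hf : ∀ x, f (f x) = x) (hpos : ∀ i j, 0 ≤ f (simpleRoot i) j) (i : Fin 8) :
    ∃ j, f (simpleRoot i) = simpleRoot j := by
  have hne (k : Fin 8) : f (simpleRoot k) ≠ 0 := fun h => by
    have := hf (simpleRoot k)
    rw [h, map_zero] at this
    have := congrFun this k
    simp [simpleRoot] at this
  have hht (k : Fin 8) : 1 ≤ ∑ j, f (simpleRoot k) j := by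
    by_contra hlt
    have h0 : ∑ j, f (simpleRoot k) j = 0 :=
      le_antisymm (by omega) (Finset.sum_nonneg fun j _ => hpos k j)
    rw [Finset.sum_eq_zero_iff_of_nonneg fun j _ => hpos k j] at h0
    exact hne k (funext fun j => h0 j (Finset.mem_univ j))
  -- Take heights, that is, pair with the Weyl vector, in `f (f αᵢ) = αᵢ`. As every height on the
  -- left is at least 1, the nonnegative coefficients of `f αᵢ` add up to at most 1.
  have hsum : ∑ j, f (simpleRoot i) j * ∑ k, f (simpleRoot j) k = 1 := by
    have h := hf (simpleRoot i)
    rw [eq_sum_simpleRoot (f (simpleRoot i)), map_sum] at h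
    have h2 := congrArg (formE8 weylVector) h
    simp only [map_sum, map_smul, formE8_weylVector, smul_eq_mul] at h2
    rw [h2]
    simp [simpleRoot]
  have hle : ∑ j, f (simpleRoot i) j ≤ 1 := by
    rw [← hsum]
    exact Finset.sum_le_sum fun j _ => le_mul_of_one_le_right (hpos i j) (hht j)
  have hone : ∑ j, f (simpleRoot i) j = 1 := le_antisymm hle (hht i)
  obtain ⟨j, hj⟩ : ∃ j, 0 < f (simpleRoot i) j := by
    by_contra! hall
    have := Finset.sum_nonpos fun j (_ : j ∈ Finset.univ) => hall j
    omega
  refine ⟨j, ?_⟩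
  rw [← Finset.add_sum_erase _ _ (Finset.mem_univ j)] at hone
  have hrest : 0 ≤ ∑ k ∈ Finset.univ.erase j, f (simpleRoot i) k :=
    Finset.sum_nonneg fun k _ => hpos i k
  have hrest0 : ∑ k ∈ Finset.univ.erase j, f (simpleRoot i) k = 0 := by omega
  rw [Finset.sum_eq_zero_iff_of_nonneg fun k _ => hpos i k] at hrest0
  ext k
  rcases eq_or_ne k j with rfl | hk
  · simp only [simpleRoot, Pi.single_eq_same] at *
    omega
  · rw [hrest0 k (by simp [hk])]
    simp [simpleRoot, hk]

/-- Positivity of `v` makes `f` preserve positive roots, hence permute the simple roots and likewise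
the fundamental weights. The latter have distinct norms, so the permutation is trivial. -/
theorem eq_self_of_fixes_dominant {f : (Fin 8 → ℤ) →ₗ[ℤ] (Fin 8 → ℤ)}
    (hiso : ∀ x y, formE8 (f x) (f y) = formE8 x y) (hf : ∀ x, f (f x) = x)
    {v : Fin 8 → ℤ} (hfv : f v = v) (hv : ∀ i, 0 < formE8 v (simpleRoot i)) (x : Fin 8 → ℤ) :
    f x = x := by
  have hpos (i j : Fin 8) : 0 ≤ f (simpleRoot i) j := by
    have hroot : formE8 (f (simpleRoot i)) (f (simpleRoot i)) = 2 := by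
      rw [hiso, isRoot_simpleRoot]
    rcases root_nonneg_or_nonpos hroot with h | h
    · exact h j
    · exfalso
      have h1 : formE8 v (f (simpleRoot i)) = formE8 v (simpleRoot i) := by
        conv_lhs => rw [← hfv]
        exact hiso _ _
      have h2 : formE8 v (f (simpleRoot i)) ≤ 0 := by
        rw [formE8_eq_sum_simpleRoot]
        exact Finset.sum_nonpos fun k _ => mul_nonpos_of_nonpos_of_nonneg (h k) (hv k).le
      have := hv i
      omega
  choose σ hσ using exists_simpleRoot_eq_of_nonneg hf hpos
  have hinj : Function.Injective simpleRoot := fun i j h => by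
    by_contra hij
    have := congrFun h i
    simp [simpleRoot, hij] at this
  have hσσ (i : Fin 8) : σ (σ i) = i := hinj (by rw [← hσ, ← hσ, hf])
  have hw (i : Fin 8) : f (fundamentalWeight i) = fundamentalWeight (σ i) := by
    refine eq_of_formE8_eq fun z => ?_
    rw [← hiso, hf, formE8_fundamentalWeight, formE8_fundamentalWeight]
    conv_lhs => rw [eq_sum_simpleRoot z]
    rw [map_sum]
    simp only [map_smul, hσ, Finset.sum_apply, Pi.smul_apply, smul_eq_mul]
    rw [Finset.sum_eq_single (σ i)]
    · simp [hσσ, simpleRoot]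
    · intro b _ hb
      have hib : i ≠ σ b := by
        rintro rfl
        exact hb (hσσ b).symm
      simp [simpleRoot, hib]
    · simp
  have hfix (i : Fin 8) : σ i = i := by
    refine eq_of_fundamentalWeight_norm_eq ?_
    rw [← hw, hiso]
  rw [eq_sum_simpleRoot x, map_sum]
  simp only [map_smul, hσ, hfix]

/-- Reflecting `v` in a simple root `r` with `(v, r) < 0` changes the squared distance to the Weyl
vector by `2 (v, r)`, because that vector pairs to 1 with `r`. Conjugating `f` along, the descent
ends at a dominant vector. -/
theorem eq_self_of_fixes_regular {f : (Fin 8 → ℤ) →ₗ[ℤ] (Fin 8 → ℤ)}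
    (hiso : ∀ x y, formE8 (f x) (f y) = formE8 x y) (hf : ∀ x, f (f x) = x)
    {v : Fin 8 → ℤ} (hfv : f v = v) (hv : ∀ r, formE8 r r = 2 → formE8 v r ≠ 0)
    (x : Fin 8 → ℤ) : f x = x := by
  induction hn : (formE8 (v - weylVector) (v - weylVector)).toNat using Nat.strong_induction_on
    generalizing f v x with
  | _ n ih =>
    by_cases hdom : ∀ i, 0 < formE8 v (simpleRoot i)
    · exact eq_self_of_fixes_dominant hiso hf hfv hdom x
    push Not at hdom
    obtain ⟨i, hi⟩ := hdom
    set r := simpleRoot i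
    have hr : formE8 r r = 2 := isRoot_simpleRoot i
    replace hi : formE8 v r < 0 := lt_of_le_of_ne hi (hv r hr)
    set s := rootReflection r
    have hss := rootReflection_rootReflection hr
    have hsiso := formE8_rootReflection hr
    have hlt : (formE8 (s v - weylVector) (s v - weylVector)).toNat < n := by
      have h1 : formE8 weylVector r = 1 := by
        rw [formE8_weylVector]
        simp [r, simpleRoot]
      have h2 : formE8 (s v - weylVector) (s v - weylVector) =
          formE8 (v - weylVector) (v - weylVector) + 2 * formE8 v r := by
        simp only [map_sub, LinearMap.sub_apply, s, hsiso]
        simp only [rootReflection_apply, map_sub, LinearMap.sub_apply, map_smul,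
          LinearMap.smul_apply, smul_eq_mul, formE8_comm r, h1]
        ring
      have h3 := formE8_self_nonneg (v - weylVector)
      have h4 := formE8_self_nonneg (s v - weylVector)
      omega
    have key := ih _ hlt (f := s ∘ₗ f ∘ₗ s) (v := s v)
      (fun x y => by simp only [LinearMap.comp_apply, s, hsiso, hiso])
      (fun x => by simp only [LinearMap.comp_apply, s, hss, hf])
      (by simp only [LinearMap.comp_apply, s, hss, hfv])
      (fun t ht => by
        rw [← hss t, hsiso]
        exact hv _ (by rw [hsiso, ht]))
      (s x) rfl
    simp only [LinearMap.comp_apply, s, hss] at key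
    rw [← hss (f x), key, hss]

theorem exists_mem_forall_formE8_ne_zero (P : Submodule ℤ (Fin 8 → ℤ))
    (T : Finset (Fin 8 → ℤ)) (hT : ∀ r ∈ T, ∃ x ∈ P, formE8 x r ≠ 0) :
    ∃ x ∈ P, ∀ r ∈ T, formE8 x r ≠ 0 := by
  classical
  induction T using Finset.induction_on with
  | empty => exact ⟨0, P.zero_mem, by simp⟩
  | insert r T hr ih =>
    obtain ⟨x, hxP, hx⟩ := ih fun t ht => hT t (Finset.mem_insert_of_mem ht)
    by_cases hxr : formE8 x r = 0
    · obtain ⟨y, hyP, hy⟩ := hT r (Finset.mem_insert_self r T)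
      -- With `N` this large, `N (x, t)` cannot be cancelled by `(y, t)`, so `N x + y` keeps the old
      -- conditions and gains the one at `r`.
      obtain ⟨N, hN⟩ : ∃ N : ℤ, ∀ t ∈ T, |formE8 y t| < N :=
        ⟨1 + ∑ t ∈ T, |formE8 y t|, fun t ht => by
          have := Finset.single_le_sum (f := fun t => |formE8 y t|) (fun _ _ => abs_nonneg _) ht
          linarith⟩
      refine ⟨N • x + y, P.add_mem (P.smul_mem N hxP) hyP, fun t ht => ?_⟩
      simp only [map_add, map_smul, LinearMap.add_apply, LinearMap.smul_apply, smul_eq_mul]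
      rcases Finset.mem_insert.1 ht with rfl | ht
      · simpa [hxr] using hy
      · intro h0
        have hNt := hN t ht
        have hNpos : 0 ≤ N := (abs_nonneg _).trans hNt.le
        have h2 : |formE8 y t| = N * |formE8 x t| := by
          rw [eq_neg_of_add_eq_zero_right h0, abs_neg, abs_mul, abs_of_nonneg hNpos]
        have h4 : N ≤ N * |formE8 x t| :=
          le_mul_of_one_le_right hNpos (Int.one_le_abs (hx t ht))
        linarith
    · refine ⟨x, hxP, fun t ht => ?_⟩
      rcases Finset.mem_insert.1 ht with rfl | ht
      · exact hxr
      · exact hx t ht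

/-- If `r` is not negated, then `r + f r` is a nonzero fixed vector with norm `2 (r + f r, r)`,
hence not orthogonal to `r`. If no root is negated, a generic fixed vector is therefore regular. -/
theorem exists_root_neg_of_ne_id {f : (Fin 8 → ℤ) →ₗ[ℤ] (Fin 8 → ℤ)}
    (hiso : ∀ x y, formE8 (f x) (f y) = formE8 x y) (hf : ∀ x, f (f x) = x)
    (hne : ∃ x, f x ≠ x) : ∃ r, formE8 r r = 2 ∧ f r = -r := by
  by_contra! hno
  obtain ⟨x, hx⟩ := hne
  let P : Submodule ℤ (Fin 8 → ℤ) := LinearMap.eqLocus f LinearMap.id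
  obtain ⟨v, hvP, hv⟩ := exists_mem_forall_formE8_ne_zero P finite_roots.toFinset fun r hr => by
    have hr : formE8 r r = 2 := by simpa using hr
    by_contra! hall
    have hmem : r + f r ∈ P := by
      change f (r + f r) = r + f r
      rw [map_add, hf, add_comm]
    have h1 := hall _ hmem
    refine hno r hr (eq_neg_of_add_eq_zero_right (eq_zero_of_formE8_self_eq_zero ?_))
    have h2 : formE8 (r + f r) (f r) = formE8 (r + f r) r := by
      rw [← hiso, hf, map_add, hf, add_comm]
    rw [map_add, h2, h1, add_zero]
  exact hx (eq_self_of_fixes_regular hiso hf (v := v) hvP (fun r hr => hv r (by simpa using hr)) x)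

/-! ### Doubly even binary codes of length at most seven -/

open scoped symmDiff in
/-- A family of subsets of a set `R` with at most seven elements that covers `R`, is closed under
symmetric difference and has all cardinalities divisible by four is one of three codes. -/
theorem doublyEven_code_cases {α : Type*} [DecidableEq α] {R : Finset α} {H : Finset α → Prop}
    (hsub : ∀ S, H S → S ⊆ R) (hcard : ∀ S, H S → 4 ∣ S.card)
    (hsymm : ∀ S T, H S → H T → H (S ∆ T)) (hcover : ∀ r ∈ R, ∃ S, H S ∧ r ∈ S)
    (hne : R.Nonempty) (h7 : R.card ≤ 7) :
    (∃ r : Fin 4 → α, r.Injective ∧ Finset.univ.image r = R ∧ H {r 0, r 1, r 2, r 3}) ∨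
    (∃ r : Fin 6 → α, r.Injective ∧ Finset.univ.image r = R ∧ H {r 0, r 1, r 2, r 3} ∧
      H {r 2, r 3, r 4, r 5}) ∨
    ∃ r : Fin 7 → α, r.Injective ∧ Finset.univ.image r = R ∧ H {r 0, r 1, r 2, r 3} ∧
      H {r 2, r 3, r 4, r 5} ∧ H {r 0, r 2, r 4, r 6} := by
  have hfour (S : Finset α) (hS : H S) (hS' : S.Nonempty) : S.card = 4 := by
    obtain ⟨k, hk⟩ := hcard S hS
    have := Finset.card_le_card (hsub S hS)
    have := hS'.card_pos
    omega
  have hinter (S T : Finset α) (hS : H S) (hT : H T) (hS' : S.card = 4) (hT' : T.card = 4)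
      (x : α) (hxS : x ∉ S) (hxT : x ∈ T) :
      (S ∩ T).card = 2 ∧ (S \ T).card = 2 ∧ (T \ S).card = 2 := by
    have h1 := hfour _ (hsymm S T hS hT) ⟨x, by simp [Finset.mem_symmDiff, hxS, hxT]⟩
    have h2 : (S ∆ T).card = (S \ T).card + (T \ S).card :=
      Finset.card_union_of_disjoint disjoint_sdiff_sdiff
    have h3 := Finset.card_inter_add_card_sdiff S T
    have h4 := Finset.card_inter_add_card_sdiff T S
    rw [Finset.inter_comm T S] at h4
    omega
  have hinj {n : ℕ} (r : Fin n → α) (him : Finset.univ.image r = R) (hn : R.card = n) :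
      r.Injective := by
    have h := Finset.card_image_iff.1 (show (Finset.univ.image r).card = Finset.univ.card by
      rw [him, hn, Finset.card_univ, Fintype.card_fin])
    rwa [Finset.coe_univ, Set.injOn_univ] at h
  obtain ⟨r₀, hr₀⟩ := hne
  obtain ⟨S, hS, hrS⟩ := hcover r₀ hr₀
  have hS4 := hfour S hS ⟨r₀, hrS⟩
  by_cases hSR : S = R
  · left
    obtain ⟨a, b, c, d, -, -, -, -, -, -, rfl⟩ := Finset.card_eq_four.1 hS4
    have him : Finset.univ.image ![a, b, c, d] = R := by
      rw [← hSR]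
      ext x
      simp [Fin.exists_fin_succ, eq_comm]
    exact ⟨![a, b, c, d], hinj _ him (hSR ▸ hS4), him, hS⟩
  right
  obtain ⟨t, htR, htS⟩ : ∃ t ∈ R, t ∉ S := by
    by_contra! hall
    exact hSR (Finset.Subset.antisymm (hsub S hS) hall)
  obtain ⟨T, hT, htT⟩ := hcover t htR
  have hT4 := hfour T hT ⟨t, htT⟩
  obtain ⟨h1, h2, h3⟩ := hinter S T hS hT hS4 hT4 t htS htT
  have hST : (S ∪ T).card = 6 := by
    have := Finset.card_union_add_card_inter S T
    omega
  have hSTR : S ∪ T ⊆ R := Finset.union_subset (hsub S hS) (hsub T hT)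
  by_cases hR : S ∪ T = R
  · left
    obtain ⟨a, b, -, hab⟩ := Finset.card_eq_two.1 h2
    obtain ⟨c, d, -, hcd⟩ := Finset.card_eq_two.1 h1
    obtain ⟨e, f, -, hef⟩ := Finset.card_eq_two.1 h3
    have hSeq : S = {a, b, c, d} := by
      rw [← Finset.sdiff_union_inter S T, hab, hcd]
      ext x
      simp only [Finset.mem_union, Finset.mem_insert, Finset.mem_singleton]
      clear * -
      grind
    have hTeq : T = {c, d, e, f} := by
      rw [← Finset.sdiff_union_inter T S, hef, Finset.inter_comm, hcd, Finset.union_comm]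
      ext x
      simp only [Finset.mem_union, Finset.mem_insert, Finset.mem_singleton]
      clear * -
      grind
    have him : Finset.univ.image ![a, b, c, d, e, f] = R := by
      rw [← hR, hSeq, hTeq]
      ext x
      simp only [Finset.mem_image, Finset.mem_univ, true_and, Fin.exists_fin_succ,
        Matrix.cons_val_zero,
        Matrix.cons_val_succ, IsEmpty.exists_iff, Finset.mem_union, Finset.mem_insert,
        Finset.mem_singleton]
      clear * -
      grind
    exact ⟨![a, b, c, d, e, f], hinj _ him (hR ▸ hST), him, hSeq ▸ hS, hTeq ▸ hT⟩
  right
  obtain ⟨u, huR, hu⟩ : ∃ u ∈ R, u ∉ S ∪ T := by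
    by_contra! hall
    exact hR (Finset.Subset.antisymm hSTR hall)
  rw [Finset.mem_union, not_or] at hu
  obtain ⟨U, hU, huU⟩ := hcover u huR
  have hU4 := hfour U hU ⟨u, huU⟩
  obtain ⟨hSU, -, -⟩ := hinter S U hS hU hS4 hU4 u hu.1 huU
  obtain ⟨hTU, -, -⟩ := hinter T U hT hU hT4 hU4 u hu.2 huU
  have hReq : R = insert u (S ∪ T) := by
    refine (Finset.eq_of_subset_of_card_le (Finset.insert_subset huR hSTR) ?_).symm
    rw [Finset.card_insert_of_notMem (by simpa using hu)]
    omega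
  have hR7 : R.card = 7 := by
    rw [hReq, Finset.card_insert_of_notMem (by simpa using hu), hST]
  have hUeq : (U ∩ (S ∪ T)).card = 3 := by
    have h5 : U = insert u (U ∩ (S ∪ T)) := by
      ext x
      have := Finset.mem_of_subset (a := x) (hsub U hU)
      rw [hReq] at this
      simp only [Finset.mem_insert, Finset.mem_inter] at this ⊢
      constructor
      · intro hx
        rcases this hx with h | h
        · exact Or.inl h
        · exact Or.inr ⟨hx, h⟩
      · rintro (rfl | h)
        · exact huU
        · exact h.1
    have h6 : u ∉ U ∩ (S ∪ T) := by simp [hu]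
    have h7 := congrArg Finset.card h5
    rw [Finset.card_insert_of_notMem h6] at h7
    omega
  -- As `S ∩ U` and `T ∩ U` have two elements each and `U ∩ (S ∪ T)` has three, `S ∩ T ∩ U` has one.
  -- So `U` cuts each of the two-element blocks `S \ T`, `S ∩ T`, `T \ S` in a single point.
  have e1 := Finset.card_inter_add_card_sdiff (S ∩ U) T
  have e2 := Finset.card_inter_add_card_sdiff (T ∩ U) S
  have e3 := Finset.card_union_add_card_inter (S ∩ U) (T ∩ U)
  have e4 : S ∩ U ∪ T ∩ U = U ∩ (S ∪ T) := by clear * -; ext x; grind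
  have e5 : (S ∩ U) ∩ (T ∩ U) = S ∩ T ∩ U := by clear * -; ext x; grind
  have e6 : T ∩ U ∩ S = S ∩ T ∩ U := by clear * -; ext x; grind
  have e7 : S ∩ U ∩ T = S ∩ T ∩ U := by clear * -; ext x; grind
  have e8 : (S ∩ U) \ T = (S \ T) ∩ U := by clear * -; ext x; grind
  have e9 : (T ∩ U) \ S = (T \ S) ∩ U := by clear * -; ext x; grind
  rw [e4, e5] at e3
  rw [e7, e8] at e1
  rw [e6, e9] at e2
  have e10 := Finset.card_inter_add_card_sdiff (S \ T) U
  have e11 := Finset.card_inter_add_card_sdiff (S ∩ T) U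
  have e12 := Finset.card_inter_add_card_sdiff (T \ S) U
  obtain ⟨a, ha⟩ := Finset.card_eq_one.1 (show ((S \ T) ∩ U).card = 1 by omega)
  obtain ⟨b, hb⟩ := Finset.card_eq_one.1 (show ((S \ T) \ U).card = 1 by omega)
  obtain ⟨c, hc⟩ := Finset.card_eq_one.1 (show (S ∩ T ∩ U).card = 1 by omega)
  obtain ⟨d, hd⟩ := Finset.card_eq_one.1 (show ((S ∩ T) \ U).card = 1 by omega)
  obtain ⟨e, he⟩ := Finset.card_eq_one.1 (show ((T \ S) ∩ U).card = 1 by omega)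
  obtain ⟨f, hf⟩ := Finset.card_eq_one.1 (show ((T \ S) \ U).card = 1 by omega)
  have hSeq : S = {a, b, c, d} := by
    rw [← Finset.sdiff_union_inter S T, ← Finset.sdiff_union_inter (S \ T) U,
      ← Finset.sdiff_union_inter (S ∩ T) U, ha, hb, hc, hd]
    ext x
    simp only [Finset.mem_union, Finset.mem_insert, Finset.mem_singleton]
    clear * -
    grind
  have hTeq : T = {c, d, e, f} := by
    rw [← Finset.sdiff_union_inter T S, ← Finset.sdiff_union_inter (T \ S) U, Finset.inter_comm T,
      ← Finset.sdiff_union_inter (S ∩ T) U, he, hf, hc, hd]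
    ext x
    simp only [Finset.mem_union, Finset.mem_insert, Finset.mem_singleton]
    clear * -
    grind
  have hUeq : U = {a, c, e, u} := by
    ext x
    have hx1 := Finset.ext_iff.1 ha x
    have hx2 := Finset.ext_iff.1 hc x
    have hx3 := Finset.ext_iff.1 he x
    have hx4 := Finset.mem_of_subset (a := x) (hsub U hU)
    rw [hReq] at hx4
    simp only [Finset.mem_insert, Finset.mem_inter, Finset.mem_sdiff, Finset.mem_singleton,
      Finset.mem_union] at hx1 hx2 hx3 hx4 ⊢
    constructor
    · intro hx
      by_cases hxS : x ∈ S
      · by_cases hxT : x ∈ T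
        · exact Or.inr (Or.inl (hx2.1 ⟨⟨hxS, hxT⟩, hx⟩))
        · exact Or.inl (hx1.1 ⟨⟨hxS, hxT⟩, hx⟩)
      · by_cases hxT : x ∈ T
        · exact Or.inr (Or.inr (Or.inl (hx3.1 ⟨⟨hxT, hxS⟩, hx⟩)))
        · exact Or.inr (Or.inr (Or.inr ((hx4 hx).resolve_right fun h => h.elim hxS hxT)))
    · rintro (h | h | h | rfl)
      · exact (hx1.2 h).2
      · exact (hx2.2 h).2
      · exact (hx3.2 h).2
      · exact huU
  have him : Finset.univ.image ![a, b, c, d, e, f, u] = R := by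
    rw [hReq, hSeq, hTeq]
    ext x
    simp only [Finset.mem_image, Finset.mem_univ, true_and, Fin.exists_fin_succ,
        Matrix.cons_val_zero,
      Matrix.cons_val_succ, IsEmpty.exists_iff, Finset.mem_union, Finset.mem_insert,
      Finset.mem_singleton]
    clear * -
    grind
  exact ⟨![a, b, c, d, e, f, u], hinj _ him hR7, him, hSeq ▸ hS, hTeq ▸ hT, hUeq ▸ hU⟩

/-! ### Involutions as products of orthogonal reflections -/

/-- A finite set of pairwise orthogonal roots of `E₈`. -/
def IsOrthogonalRootSet (R : Finset (Fin 8 → ℤ)) : Prop :=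
  ∀ r ∈ R, ∀ s ∈ R, formE8 r s = if r = s then 2 else 0

theorem IsOrthogonalRootSet.formE8_sum {R : Finset (Fin 8 → ℤ)} (hR : IsOrthogonalRootSet R)
    {r : Fin 8 → ℤ} (hr : r ∈ R) (c : (Fin 8 → ℤ) → ℤ) :
    formE8 r (∑ s ∈ R, c s • s) = 2 * c r := by
  simp only [map_sum, map_smul, smul_eq_mul]
  rw [Finset.sum_eq_single r, hR r hr r hr, if_pos rfl, mul_comm]
  · intro s hs hsr
    rw [hR r hr s hs, if_neg hsr.symm, mul_zero]
  · exact fun h => absurd hr h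

theorem card_le_eight_of_pairwise_orthogonal {R : Finset (Fin 8 → ℤ)}
    (hne : ∀ r ∈ R, r ≠ 0) (horth : ∀ r ∈ R, ∀ s ∈ R, r ≠ s → formE8 r s = 0) : R.card ≤ 8 := by
  have hli : LinearIndependent ℤ ((↑) : R → Fin 8 → ℤ) := by
    rw [linearIndependent_iff']
    intro s g hg i hi
    have h := congrArg (formE8 i.1) hg
    simp only [map_sum, map_smul, smul_eq_mul, map_zero] at h
    rw [Finset.sum_eq_single_of_mem i hi] at h
    · refine (mul_eq_zero.1 h).resolve_right fun h0 => ?_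
      exact hne i i.2 (eq_zero_of_formE8_self_eq_zero h0)
    · intro j _ hji
      rw [horth i i.2 j j.2 fun h => hji (Subtype.ext h).symm, mul_zero]
  simpa using hli.finset_card_le_finrank

theorem IsOrthogonalRootSet.ne_zero {R : Finset (Fin 8 → ℤ)} (hR : IsOrthogonalRootSet R)
    {r : Fin 8 → ℤ} (hr : r ∈ R) : r ≠ 0 := by
  rintro rfl
  simpa using hR 0 hr 0 hr

theorem IsOrthogonalRootSet.card_le {R : Finset (Fin 8 → ℤ)} (hR : IsOrthogonalRootSet R) :
    R.card ≤ 8 :=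
  card_le_eight_of_pairwise_orthogonal (fun _ hr => hR.ne_zero hr)
    fun r hr s hs hrs => by rw [hR r hr s hs, if_neg hrs]

theorem IsOrthogonalRootSet.eq_zero_of_card_eq {R : Finset (Fin 8 → ℤ)}
    (hR : IsOrthogonalRootSet R) (h8 : R.card = 8) {x : Fin 8 → ℤ}
    (hx : ∀ r ∈ R, formE8 r x = 0) : x = 0 := by
  by_contra hx0
  have hxR : x ∉ R := fun h => hx0 (eq_zero_of_formE8_self_eq_zero (hx x h))
  have := card_le_eight_of_pairwise_orthogonal (R := insert x R)
    (by
      intro r hr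
      rcases Finset.mem_insert.1 hr with rfl | hr
      · exact hx0
      · exact hR.ne_zero hr)
    (by
      intro r hr s hs hrs
      rcases Finset.mem_insert.1 hr with rfl | hr' <;>
        rcases Finset.mem_insert.1 hs with rfl | hs'
      · exact absurd rfl hrs
      · rw [formE8_comm, hx s hs']
      · rw [hx r hr']
      · rw [hR r hr' s hs', if_neg hrs])
  rw [Finset.card_insert_of_notMem hxR, h8] at this
  omega

/-- Every involutive isometry of `E₈` is a product of reflections in pairwise orthogonal roots. -/
theorem exists_isOrthogonalRootSet {f : (Fin 8 → ℤ) →ₗ[ℤ] (Fin 8 → ℤ)}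
    (hiso : ∀ x y, formE8 (f x) (f y) = formE8 x y) (hf : ∀ x, f (f x) = x) :
    ∃ R, IsOrthogonalRootSet R ∧ ∀ x, f x = x - ∑ r ∈ R, formE8 r x • r := by
  classical
  by_contra! hno
  -- Under the contrary assumption, orthogonal sets of roots negated by `f` can be enlarged forever,
  -- past the rank 8.
  have key (n : ℕ) : ∃ R, IsOrthogonalRootSet R ∧ (∀ r ∈ R, f r = -r) ∧ R.card = n := by
    induction n with
    | zero => exact ⟨∅, by simp [IsOrthogonalRootSet], by simp, rfl⟩
    | succ n ih =>
      obtain ⟨R, hR, hneg, hcard⟩ := ih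
      obtain ⟨x, hx⟩ := hno R hR
      let p : (Fin 8 → ℤ) →ₗ[ℤ] (Fin 8 → ℤ) := ∑ r ∈ R, (formE8 r).smulRight r
      have hp (y) : p y = ∑ r ∈ R, formE8 r y • r := by simp [p, LinearMap.sum_apply]
      have hfp (y) : f (p y) = -p y := by
        rw [hp, map_sum, ← Finset.sum_neg_distrib]
        refine Finset.sum_congr rfl fun r hr => ?_
        rw [map_smul, hneg r hr, smul_neg]
      have hpr (r) (hr : r ∈ R) (y) : formE8 r (p y) = 2 * formE8 r y := by
        rw [hp, hR.formE8_sum hr]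
      have hpf (y) : p (f y) = -p y := by
        rw [hp, hp, ← Finset.sum_neg_distrib]
        refine Finset.sum_congr rfl fun r hr => ?_
        rw [← hiso, hf, hneg r hr, map_neg, LinearMap.neg_apply, neg_smul]
      have hpp (y) : p (p y) = 2 • p y := by
        rw [hp, hp, Finset.smul_sum]
        refine Finset.sum_congr rfl fun r hr => ?_
        rw [← hp, hpr r hr, mul_smul]
        norm_cast
      have hpB (y z) : formE8 (p y) z = formE8 y (p z) := by
        rw [hp, hp, map_sum, map_sum, LinearMap.sum_apply]
        refine Finset.sum_congr rfl fun r hr => ?_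
        rw [map_smul, map_smul, LinearMap.smul_apply, smul_eq_mul, smul_eq_mul, formE8_comm y r,
          mul_comm]
      -- Since `f ∘ p = -p`, the map `f + p` is `f ∘ (1 - p)`, that is, `f` after the reflections in
      -- `R`. It is again an involutive isometry, and not the identity.
      obtain ⟨r, hr, hfr⟩ := exists_root_neg_of_ne_id (f := f + p)
        (fun y z => by
          simp only [LinearMap.add_apply, map_add, hiso]
          rw [hpB, hpB, hpf, hpp, formE8_comm (f y), hpB, hpf, map_neg, map_neg, formE8_comm z,
            hpB, map_nsmul]
          simp
          ring)
        (fun y => by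
          simp only [LinearMap.add_apply, map_add, hf, hpp, hfp, hpf]
          module)
        ⟨x, fun h => hx (by rw [← hp]; exact eq_sub_of_add_eq h)⟩
      -- The map `f + p` preserves the pairing with `s`, yet it negates `r`.
      have hrR (s) (hs : s ∈ R) : formE8 s r = 0 := by
        have h1 : (f + p) s = s := by
          rw [LinearMap.add_apply, hneg s hs, hp]
          rw [Finset.sum_eq_single s]
          · rw [hR s hs s hs, if_pos rfl]
            module
          · intro t ht hts
            rw [hR t ht s hs, if_neg hts, zero_smul]
          · exact fun h => absurd hs h
        have h2 : formE8 s ((f + p) r) = formE8 s r := by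
          rw [LinearMap.add_apply, map_add, hpr s hs, ← hiso, hf, hneg s hs, map_neg,
            LinearMap.neg_apply]
          ring
        rw [hfr, map_neg] at h2
        linarith
      have hpr0 : p r = 0 := by
        rw [hp]
        exact Finset.sum_eq_zero fun s hs => by rw [hrR s hs, zero_smul]
      rw [LinearMap.add_apply, hpr0, add_zero] at hfr
      have hrn : r ∉ R := fun h => by
        rw [hrR r h] at hr
        norm_num at hr
      refine ⟨insert r R, ?_, ?_, by rw [Finset.card_insert_of_notMem hrn, hcard]⟩
      · intro s hs t ht
        rcases Finset.mem_insert.1 hs with rfl | hs' <;>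
          rcases Finset.mem_insert.1 ht with rfl | ht'
        · simp [hr]
        · rw [formE8_comm, hrR t ht', if_neg]
          rintro rfl
          exact hrn ht'
        · rw [hrR s hs', if_neg]
          rintro rfl
          exact hrn hs'
        · exact hR s hs' t ht'
      · intro s hs
        rcases Finset.mem_insert.1 hs with rfl | hs
        · exact hfr
        · exact hneg s hs
  obtain ⟨R, hR, -, h9⟩ := key 9
  have := hR.card_le
  omega

/-! ### The code of subsets of `R` with sum in `2E₈` -/

theorem exists_two_smul_of_even {x : Fin 8 → ℤ} (hx : ∀ y, Even (formE8 x y)) :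
    ∃ z : Fin 8 → ℤ, x = (2 : ℤ) • z := by
  have h (i : Fin 8) : ∃ k, x i = 2 * k := by
    rw [← formE8_fundamentalWeight i x, formE8_comm]
    exact even_iff_exists_two_mul.1 (hx _)
  choose z hz using h
  exact ⟨z, funext hz⟩

/-- The norm of the sum is `2|S|`, but also `4 (z, z)` with `(z, z)` even. -/
theorem IsOrthogonalRootSet.four_dvd_card {S : Finset (Fin 8 → ℤ)} (hS : IsOrthogonalRootSet S)
    {z : Fin 8 → ℤ} (hz : ∑ s ∈ S, s = (2 : ℤ) • z) : 4 ∣ S.card := by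
  have h1 : formE8 (∑ s ∈ S, s) (∑ s ∈ S, s) = 2 * S.card := by
    have := fun r (hr : r ∈ S) => hS.formE8_sum hr fun _ => 1
    simp only [one_smul] at this
    rw [map_sum formE8, LinearMap.sum_apply, Finset.sum_congr rfl this]
    simp [mul_comm]
  rw [hz] at h1
  obtain ⟨k, hk⟩ := even_formE8_self z
  simp only [map_smul, LinearMap.smul_apply, hk, smul_eq_mul] at h1
  omega

open scoped symmDiff in
theorem exists_two_smul_symmDiff {S T : Finset (Fin 8 → ℤ)}
    (hS : ∃ z, ∑ s ∈ S, s = (2 : ℤ) • z) (hT : ∃ z, ∑ s ∈ T, s = (2 : ℤ) • z) :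
    ∃ z, ∑ s ∈ S ∆ T, s = (2 : ℤ) • z := by
  obtain ⟨u, hu⟩ := hS
  obtain ⟨v, hv⟩ := hT
  refine ⟨u + v - ∑ s ∈ S ∩ T, s, ?_⟩
  have h1 : ∑ s ∈ S ∆ T, s = ∑ s ∈ S \ T, s + ∑ s ∈ T \ S, s :=
    Finset.sum_union disjoint_sdiff_sdiff
  have h2 := Finset.sum_inter_add_sum_sdiff S T id
  have h3 := Finset.sum_inter_add_sum_sdiff T S id
  simp only [id] at h2 h3
  rw [Finset.inter_comm] at h3
  rw [h1, smul_sub, smul_add, ← hu, ← hv, ← h2, ← h3]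
  module

/-- If the root `r` is not of the form `f x - x`, then it belongs to a set of roots in `R` whose sum
is divisible by two. -/
theorem IsOrthogonalRootSet.exists_half_sum {R : Finset (Fin 8 → ℤ)} (hR : IsOrthogonalRootSet R)
    {r : Fin 8 → ℤ} (hr : r ∈ R) (hnot : ∀ x, ∑ s ∈ R, formE8 s x • s ≠ r) :
    ∃ S ⊆ R, r ∈ S ∧ ∃ z, ∑ s ∈ S, s = (2 : ℤ) • z := by
  classical
  let φ : (Fin 8 → ℤ) →+ (R → ZMod 2) :=
    { toFun := fun x s => (formE8 s x : ℤ)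
      map_zero' := by ext; simp
      map_add' := fun x y => by ext; simp }
  let W : Submodule (ZMod 2) (R → ZMod 2) := AddSubgroup.toZModSubmodule 2 φ.range
  have hW (x) : φ x ∈ W := ⟨x, rfl⟩
  -- If the unit vector at `r` were the reduction of some `x`, subtracting suitable `c s • s` would
  -- remove the even discrepancies, as `(s, s) = 2`, and produce `r` exactly.
  have hrW : Pi.single (⟨r, hr⟩ : R) (1 : ZMod 2) ∉ W := by
    rintro ⟨x, hx⟩
    have hx' (s : R) : ((formE8 s x : ℤ) : ZMod 2) = ((if s.1 = r then 1 else 0 : ℤ) : ZMod 2) := by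
      have := congrFun hx s
      simp only [φ, AddMonoidHom.coe_mk, ZeroHom.coe_mk, Pi.single_apply, Subtype.ext_iff] at this
      rw [this]
      split_ifs <;> simp
    have hdvd (s : Fin 8 → ℤ) : ∃ k : ℤ, s ∈ R → formE8 s x = (if s = r then 1 else 0) + 2 * k := by
      by_cases hs : s ∈ R
      · have := (ZMod.intCast_eq_intCast_iff_dvd_sub _ _ 2).1 (hx' ⟨s, hs⟩).symm
        obtain ⟨k, hk⟩ := this
        exact ⟨k, fun _ => by push_cast at hk; linarith⟩
      · exact ⟨0, fun h => absurd h hs⟩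
    choose c hc using hdvd
    refine hnot (x - ∑ s ∈ R, c s • s) ?_
    have (s) (hs : s ∈ R) : formE8 s (x - ∑ t ∈ R, c t • t) • s = if s = r then s else 0 := by
      rw [map_sub, hR.formE8_sum hs, hc s hs, add_sub_cancel_right]
      split_ifs <;> simp
    rw [Finset.sum_congr rfl this, Finset.sum_ite_eq' R r, if_pos hr]
  -- The support of a functional vanishing on `W` but not at `r` is the required set: its sum has
  -- even pairing with all of `E₈`.
  obtain ⟨ψ, hψr, hψW⟩ := Submodule.exists_le_ker_of_notMem hrW
  have hψ (x : R → ZMod 2) : ψ x = ∑ s, x s * ψ (Pi.single s 1) := by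
    conv_lhs => rw [← Finset.univ_sum_single x]
    rw [map_sum]
    refine Finset.sum_congr rfl fun s _ => ?_
    rw [← smul_eq_mul, ← map_smul, ← Pi.single_smul, smul_eq_mul, mul_one]
  let S : Finset (Fin 8 → ℤ) := R.attach.filter (fun s => ψ (Pi.single s 1) ≠ 0) |>.map
    (Function.Embedding.subtype _)
  refine ⟨S, fun s hs => ?_, ?_, ?_⟩
  · obtain ⟨t, -, rfl⟩ := Finset.mem_map.1 hs
    exact t.2
  · exact Finset.mem_map.2 ⟨⟨r, hr⟩, by simpa using hψr, rfl⟩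
  · refine exists_two_smul_of_even fun y => ?_
    have hy : ψ (φ y) = 0 := hψW (hW y)
    rw [hψ] at hy
    rw [even_iff_two_dvd]
    have h2 : ((formE8 (∑ s ∈ S, s) y : ℤ) : ZMod 2) = 0 := by
      rw [← hy, map_sum, LinearMap.sum_apply, Finset.sum_map, Finset.sum_filter]
      push_cast
      rw [Finset.univ_eq_attach]
      refine Finset.sum_congr rfl fun s _ => ?_
      have hz : ∀ z : ZMod 2, z ≠ 0 → z = 1 := by decide
      by_cases h : ψ (Pi.single s 1) = 0
      · simp [h]
      · rw [if_pos h, hz _ h, mul_one]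
        rfl
    exact_mod_cast (ZMod.intCast_zmod_eq_zero_iff_dvd _ 2).1 h2

/-! ### Identification of the `(-1)`-eigenlattice from half sums -/

open scoped Matrix

theorem isIsometric_gramForm_of_basis {n : ℕ} {C : Matrix (Fin n) (Fin n) ℤ} (hC : C.det ≠ 0)
    {M : Submodule ℤ (Fin 8 → ℤ)} {b : Fin n → Fin 8 → ℤ} (hbM : ∀ i, b i ∈ M)
    (hgram : ∀ i j, formE8 (b i) (b j) = C i j)
    (hspan : ∀ m ∈ M, ∃ c : Fin n → ℤ, m = ∑ i, c i • b i) :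
    IsIsometric (formE8.restrict M) (gramForm C) := by
  let g : (Fin n → ℤ) →ₗ[ℤ] M := ∑ i, (LinearMap.proj i).smulRight (⟨b i, hbM i⟩ : M)
  have hg (c) : (g c : Fin 8 → ℤ) = ∑ i, c i • b i := by
    simp [g, LinearMap.sum_apply]
  have hgB (c d) : formE8 (g c) (g d) = gramForm C c d := by
    rw [hg, hg, gramForm, Matrix.toBilin'_apply, map_sum formE8, LinearMap.sum_apply]
    refine Finset.sum_congr rfl fun i _ => ?_
    rw [map_sum]
    refine Finset.sum_congr rfl fun j _ => ?_
    rw [map_smul, map_smul, LinearMap.smul_apply, hgram, smul_eq_mul, smul_eq_mul]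
    ring
  have hinj : Function.Injective g := by
    rw [← LinearMap.ker_eq_bot, LinearMap.ker_eq_bot']
    intro c hc
    refine Matrix.eq_zero_of_mulVec_eq_zero hC (funext fun i => ?_)
    have := hgB (Pi.single i 1) c
    rw [hc, gramForm, Matrix.toBilin'_apply'] at this
    simpa using this.symm
  have hsurj : Function.Surjective g := fun m => by
    obtain ⟨c, hc⟩ := hspan m m.2
    exact ⟨c, Subtype.ext (by rw [hg, hc])⟩
  let e := LinearEquiv.ofBijective g ⟨hinj, hsurj⟩
  refine ⟨e.symm, fun x y => ?_⟩
  rw [← hgB]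
  change formE8 (e (e.symm x)) (e (e.symm y)) = formE8 x y
  rw [e.apply_symm_apply, e.apply_symm_apply]

theorem mem_negEigenlattice {h : (Fin 8 → ℤ) ≃ₗ[ℤ] (Fin 8 → ℤ)} {x : Fin 8 → ℤ} :
    x ∈ negEigenlattice h ↔ h x = -x := by
  rw [negEigenlattice, Module.End.mem_eigenspace_iff, neg_one_smul]
  rfl

section OrthogonalRoots

variable {n : ℕ} {h : (Fin 8 → ℤ) ≃ₗ[ℤ] (Fin 8 → ℤ)} {r : Fin n → Fin 8 → ℤ}

theorem two_smul_eq_of_mem_negEigenlattice (hh : ∀ x, h x = x - ∑ i, formE8 (r i) x • r i)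
    {x : Fin 8 → ℤ} (hx : x ∈ negEigenlattice h) :
    (2 : ℤ) • x = ∑ i, formE8 (r i) x • r i := by
  have h1 := hh x
  rw [mem_negEigenlattice.1 hx] at h1
  linear_combination (exp := 1) -h1

theorem formE8_sum_smul (hr : ∀ i j, formE8 (r i) (r j) = if i = j then 2 else 0)
    (c : Fin n → ℤ) (i : Fin n) : formE8 (r i) (∑ j, c j • r j) = 2 * c i := by
  simp only [map_sum, map_smul, hr, smul_eq_mul, mul_ite, mul_zero]
  rw [Finset.sum_ite_eq, if_pos (Finset.mem_univ i), mul_comm]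

/-- Pairing `2x = ∑ (rᵢ, x) rᵢ` with `x` shows that the sum is `2 (x, x)`, and `(x, x)` is even. -/
theorem four_dvd_sum_sq (hh : ∀ x, h x = x - ∑ i, formE8 (r i) x • r i)
    {x : Fin 8 → ℤ} (hx : x ∈ negEigenlattice h) :
    4 ∣ ∑ i, formE8 (r i) x * formE8 (r i) x := by
  have h1 := congrArg (fun y => formE8 y x) (two_smul_eq_of_mem_negEigenlattice hh hx)
  simp only [map_smul, map_sum, LinearMap.smul_apply, LinearMap.sum_apply, smul_eq_mul] at h1
  obtain ⟨k, hk⟩ := even_formE8_self x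
  rw [← h1, hk]
  exact ⟨k, by ring⟩

/-- If `h` is the product of the reflections in the orthogonal roots `r i`, then half sums of these
roots that have Gram matrix `C` and span the `(-1)`-eigenlattice identify it with the lattice with
Gram matrix `C`. -/
theorem isIsometric_negEigenlattice_of_half_sums
    (hr : ∀ i j, formE8 (r i) (r j) = if i = j then 2 else 0)
    (hh : ∀ x, h x = x - ∑ i, formE8 (r i) x • r i) {C : Matrix (Fin n) (Fin n) ℤ}
    (hC : C.det ≠ 0) (N : Matrix (Fin n) (Fin n) ℤ) (hN : N * Nᵀ = 2 • C)
    (hhalf : ∀ k, ∃ b : Fin 8 → ℤ, (2 : ℤ) • b = ∑ j, N k j • r j)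
    (hspan : ∀ x ∈ negEigenlattice h, ∃ c : Fin n → ℤ, ∀ j, formE8 (r j) x = (c ᵥ* N) j) :
    IsIsometric (formE8.restrict (negEigenlattice h)) (gramForm C) := by
  choose b hb using hhalf
  have hrb (i k) : formE8 (r i) (b k) = N k i := by
    have h1 := formE8_sum_smul hr (N k) i
    rw [← hb, map_smul, smul_eq_mul] at h1
    linarith
  refine isIsometric_gramForm_of_basis hC (b := b) (fun k => ?_) (fun i j => ?_) fun m hm => ?_
  · rw [mem_negEigenlattice, hh]
    simp only [hrb]
    rw [← hb]
    module
  · have h1 : formE8 ((2 : ℤ) • b i) (b j) = 2 * C i j := by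
      rw [hb, map_sum formE8, LinearMap.sum_apply]
      simp only [map_smul, LinearMap.smul_apply, hrb, smul_eq_mul]
      have := congrFun (congrFun hN i) j
      rw [Matrix.mul_apply] at this
      simpa using this
    rw [map_smul, LinearMap.smul_apply, smul_eq_mul] at h1
    linarith
  · obtain ⟨c, hc⟩ := hspan m hm
    refine ⟨c, smul_right_injective (Fin 8 → ℤ) (two_ne_zero : (2 : ℤ) ≠ 0) ?_⟩
    dsimp only
    rw [two_smul_eq_of_mem_negEigenlattice hh hm, Finset.smul_sum]
    simp only [hc, smul_comm (2 : ℤ), hb, Matrix.vecMul, dotProduct, Finset.sum_smul,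
      Finset.smul_sum, mul_smul]
    exact Finset.sum_comm

theorem formE8_add_four_eq {a b c d u x : Fin 8 → ℤ} (hu : a + b + c + d = (2 : ℤ) • u) :
    formE8 a x + formE8 b x + formE8 c x + formE8 d x = 2 * formE8 u x := by
  simpa [-zsmul_eq_mul] using congrArg (fun y => formE8 y x) hu

theorem mul_self_emod_four (X : ℤ) : X * X % 4 = X % 2 := by
  rcases Int.even_or_odd' X with ⟨k, rfl | rfl⟩
  · rw [show 2 * k * (2 * k) = 4 * (k * k) by ring]
    omega
  · rw [show (2 * k + 1) * (2 * k + 1) = 4 * (k * k + k) + 1 by ring]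
    omega

end OrthogonalRoots

theorem isIsometric_formD4 {h : (Fin 8 → ℤ) ≃ₗ[ℤ] (Fin 8 → ℤ)} {r : Fin 4 → Fin 8 → ℤ}
    (hr : ∀ i j, formE8 (r i) (r j) = if i = j then 2 else 0)
    (hh : ∀ x, h x = x - ∑ i, formE8 (r i) x • r i)
    {u : Fin 8 → ℤ} (hu : r 0 + r 1 + r 2 + r 3 = (2 : ℤ) • u) :
    IsIsometric (formE8.restrict (negEigenlattice h)) formD4 := by
  refine isIsometric_negEigenlattice_of_half_sums hr hh (by decide +kernel)
    -- Rows are simple roots in the coordinates `rᵢ / 2`; the branch node is `-u`.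
    !![2, 0, 0, 0;
       -1, -1, -1, -1;
       0, 2, 0, 0;
       0, 0, 2, 0] (by decide +kernel) ?_ fun x hx => ?_
  · simp only [Fin.forall_fin_succ, IsEmpty.forall_iff, and_true]
    refine ⟨⟨r 0, ?_⟩, ⟨-u, ?_⟩, ⟨r 1, ?_⟩, ⟨r 2, ?_⟩⟩ <;> simp [Fin.sum_univ_succ] at hu ⊢
    linear_combination hu
  · have hsq := four_dvd_sum_sq hh hx
    simp only [Fin.sum_univ_four] at hsq
    have h0 := mul_self_emod_four (formE8 (r 0) x)
    have h1 := mul_self_emod_four (formE8 (r 1) x)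
    have h2 := mul_self_emod_four (formE8 (r 2) x)
    have h3 := mul_self_emod_four (formE8 (r 3) x)
    -- The witness solves the linear system. Its halves are integers: a square modulo 4 is its
    -- parity, so the number of odd pairings is 0 or 4.
    refine ⟨![(formE8 (r 0) x - formE8 (r 3) x) / 2, -formE8 (r 3) x,
      (formE8 (r 1) x - formE8 (r 3) x) / 2, (formE8 (r 2) x - formE8 (r 3) x) / 2], ?_⟩
    simp only [Fin.forall_fin_succ, IsEmpty.forall_iff, and_true]
    simp [Matrix.vecMul, dotProduct, Fin.sum_univ_succ]
    omega

theorem isIsometric_formD6 {h : (Fin 8 → ℤ) ≃ₗ[ℤ] (Fin 8 → ℤ)} {r : Fin 6 → Fin 8 → ℤ}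
    (hr : ∀ i j, formE8 (r i) (r j) = if i = j then 2 else 0)
    (hh : ∀ x, h x = x - ∑ i, formE8 (r i) x • r i)
    {u v : Fin 8 → ℤ} (hu : r 0 + r 1 + r 2 + r 3 = (2 : ℤ) • u)
    (hv : r 2 + r 3 + r 4 + r 5 = (2 : ℤ) • v) :
    IsIsometric (formE8.restrict (negEigenlattice h)) formD6 := by
  refine isIsometric_negEigenlattice_of_half_sums hr hh (by decide +kernel)
    !![2, 0, 0, 0, 0, 0;
       -1, 1, -1, -1, 0, 0;
       0, 0, 2, 0, 0, 0;
       0, 0, -1, 1, -1, -1;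
       0, 0, 0, 0, 2, 0;
       0, 0, 0, 0, 0, 2] (by decide +kernel) ?_ fun x hx => ?_
  · simp only [Fin.forall_fin_succ, IsEmpty.forall_iff, and_true]
    refine ⟨⟨r 0, ?_⟩, ⟨u - r 0 - r 2 - r 3, ?_⟩, ⟨r 2, ?_⟩, ⟨v - r 2 - r 4 - r 5, ?_⟩,
      ⟨r 4, ?_⟩, ⟨r 5, ?_⟩⟩ <;> simp [Fin.sum_univ_succ] at hu hv ⊢
    · linear_combination -hu
    · linear_combination -hv
  · have hsq := four_dvd_sum_sq hh hx
    simp only [Fin.sum_univ_six] at hsq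
    have hu' := formE8_add_four_eq (x := x) hu
    have hv' := formE8_add_four_eq (x := x) hv
    have h0 := mul_self_emod_four (formE8 (r 0) x)
    have h1 := mul_self_emod_four (formE8 (r 1) x)
    have h2 := mul_self_emod_four (formE8 (r 2) x)
    have h3 := mul_self_emod_four (formE8 (r 3) x)
    have h4 := mul_self_emod_four (formE8 (r 4) x)
    have h5 := mul_self_emod_four (formE8 (r 5) x)
    -- The relations from `u` and `v`, with the square sum modulo 4, force the set of odd pairings
    -- to be a word of the code, which makes the halves integral.
    refine ⟨![(formE8 (r 0) x + formE8 (r 1) x) / 2, formE8 (r 1) x,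
      (formE8 (r 2) x + 2 * formE8 (r 1) x + formE8 (r 3) x) / 2, formE8 (r 1) x + formE8 (r 3) x,
      (formE8 (r 4) x + formE8 (r 1) x + formE8 (r 3) x) / 2,
      (formE8 (r 5) x + formE8 (r 1) x + formE8 (r 3) x) / 2], ?_⟩
    simp only [Fin.forall_fin_succ, IsEmpty.forall_iff, and_true]
    simp [Matrix.vecMul, dotProduct, Fin.sum_univ_succ]
    omega

theorem isIsometric_formE7 {h : (Fin 8 → ℤ) ≃ₗ[ℤ] (Fin 8 → ℤ)} {r : Fin 7 → Fin 8 → ℤ}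
    (hr : ∀ i j, formE8 (r i) (r j) = if i = j then 2 else 0)
    (hh : ∀ x, h x = x - ∑ i, formE8 (r i) x • r i)
    {u v w : Fin 8 → ℤ} (hu : r 0 + r 1 + r 2 + r 3 = (2 : ℤ) • u)
    (hv : r 2 + r 3 + r 4 + r 5 = (2 : ℤ) • v) (hw : r 0 + r 2 + r 4 + r 6 = (2 : ℤ) • w) :
    IsIsometric (formE8.restrict (negEigenlattice h)) formE7 := by
  refine isIsometric_negEigenlattice_of_half_sums hr hh (by rw [CartanMatrix.E₇_det]; norm_num)
    -- The first row comes from the word `{1, 3, 4, 6}`, the symmetric difference of the words of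
    -- `u` and `w`.
    !![0, -1, 0, -1, -1, 0, -1;
       0, 0, 0, 0, 0, 2, 0;
       0, 0, 0, 0, 2, 0, 0;
       0, 0, -1, 1, -1, -1, 0;
       0, 0, 2, 0, 0, 0, 0;
       -1, 1, -1, -1, 0, 0, 0;
       2, 0, 0, 0, 0, 0, 0] (by decide +kernel) ?_ fun x hx => ?_
  · simp only [Fin.forall_fin_succ, IsEmpty.forall_iff, and_true]
    refine ⟨⟨r 0 + r 2 - w - u, ?_⟩, ⟨r 5, ?_⟩, ⟨r 4, ?_⟩, ⟨v - r 2 - r 4 - r 5, ?_⟩, ⟨r 2, ?_⟩,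
      ⟨u - r 0 - r 2 - r 3, ?_⟩, ⟨r 0, ?_⟩⟩ <;> simp [Fin.sum_univ_succ] at hu hv hw ⊢
    · linear_combination hu + hw
    · linear_combination -hv
    · linear_combination -hu
  · have hsq := four_dvd_sum_sq hh hx
    simp only [Fin.sum_univ_seven] at hsq
    have hu' := formE8_add_four_eq (x := x) hu
    have hv' := formE8_add_four_eq (x := x) hv
    have hw' := formE8_add_four_eq (x := x) hw
    have h0 := mul_self_emod_four (formE8 (r 0) x)
    have h1 := mul_self_emod_four (formE8 (r 1) x)
    have h2 := mul_self_emod_four (formE8 (r 2) x)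
    have h3 := mul_self_emod_four (formE8 (r 3) x)
    have h4 := mul_self_emod_four (formE8 (r 4) x)
    have h5 := mul_self_emod_four (formE8 (r 5) x)
    have h6 := mul_self_emod_four (formE8 (r 6) x)
    refine ⟨![-formE8 (r 6) x,
      (formE8 (r 5) x + formE8 (r 3) x + formE8 (r 1) x - 2 * formE8 (r 6) x) / 2,
      (formE8 (r 4) x + formE8 (r 3) x + formE8 (r 1) x - 3 * formE8 (r 6) x) / 2,
      formE8 (r 3) x + formE8 (r 1) x - 2 * formE8 (r 6) x,
      (formE8 (r 2) x + formE8 (r 3) x + 2 * formE8 (r 1) x - 3 * formE8 (r 6) x) / 2,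
      formE8 (r 1) x - formE8 (r 6) x,
      (formE8 (r 0) x + formE8 (r 1) x - formE8 (r 6) x) / 2], ?_⟩
    simp only [Fin.forall_fin_succ, IsEmpty.forall_iff, and_true]
    simp [Matrix.vecMul, dotProduct, Fin.sum_univ_succ]
    omega

/-! ### From the four lattices to rootlessness -/

theorem isRootless_of_isIsometric_gramForm {h : isometryGroup formE8} (hh : ∀ x, h.1 (h.1 x) = x)
    {n : ℕ} {C : Matrix (Fin n) (Fin n) ℤ}
    (hC : ∀ v : Fin n → ℤ, (∀ i, Even ((C *ᵥ v) i)) → v ⬝ᵥ C *ᵥ v ≠ 2)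
    (hM : IsIsometric (formE8.restrict (negEigenlattice h.1)) (gramForm C)) : IsRootless h := by
  obtain ⟨e, he⟩ := hM
  rintro y ⟨x, hxy⟩ (hy : formE8 y y = 2)
  replace hxy : h.1 x - x = y := hxy
  have hyM : y ∈ negEigenlattice h.1 := by
    rw [mem_negEigenlattice, ← hxy, map_sub, hh, neg_sub]
  -- For `m` in `L⁻`, `(m, h x) = (h m, x) = -(m, x)`, so `(m, h x - x) = -2 (m, x)`.
  have heven (m : negEigenlattice h.1) : Even (formE8 m y) := by
    have h1 : formE8 m (h.1 x) = -formE8 m x := by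
      rw [← h.2, hh, mem_negEigenlattice.1 m.2, map_neg, LinearMap.neg_apply]
    rw [← hxy, map_sub, h1]
    exact ⟨-formE8 m x, by ring⟩
  refine hC (e ⟨y, hyM⟩) (fun i => ?_) ?_
  · have h1 := he (e.symm (Pi.single i 1)) ⟨y, hyM⟩
    rw [e.apply_symm_apply, gramForm, Matrix.toBilin'_apply', single_one_dotProduct] at h1
    rw [h1]
    exact heven _
  · rw [← Matrix.toBilin'_apply']
    exact (he _ _).trans hy

/-- The parity conditions make the norm divisible by 4. -/
theorem cartanD4_norm_ne_two {v : Fin 4 → ℤ} (hv : ∀ i, Even ((CartanMatrix.D 4 *ᵥ v) i)) :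
    v ⬝ᵥ CartanMatrix.D 4 *ᵥ v ≠ 2 := by
  rw [CartanMatrix.D_four] at hv ⊢
  simp only [Fin.forall_fin_succ, IsEmpty.forall_iff, and_true, even_iff_two_dvd] at hv
  simp [Matrix.mulVec, dotProduct, Fin.sum_univ_succ] at hv ⊢
  obtain ⟨a, ha⟩ : ∃ a, v 1 = 2 * a := ⟨v 1 / 2, by omega⟩
  obtain ⟨t, ht⟩ : ∃ t, v 3 = v 0 + v 2 + 2 * t := ⟨(v 3 - v 0 - v 2) / 2, by omega⟩
  rw [ha, ht]
  intro hQ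
  ring_nf at hQ
  omega

/-- The norm is divisible by 4 if `v 2` is even, and is 6 modulo 8 if `v 2` is odd; the odd case is
twice a spinor weight. -/
theorem cartanD6_norm_ne_two {v : Fin 6 → ℤ} (hv : ∀ i, Even ((CartanMatrix.D 6 *ᵥ v) i)) :
    v ⬝ᵥ CartanMatrix.D 6 *ᵥ v ≠ 2 := by
  have hD : CartanMatrix.D 6 = !![2, -1, 0, 0, 0, 0; -1, 2, -1, 0, 0, 0; 0, -1, 2, -1, 0, 0;
    0, 0, -1, 2, -1, -1; 0, 0, 0, -1, 2, 0; 0, 0, 0, -1, 0, 2] := by decide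
  rw [hD] at hv ⊢
  simp only [Fin.forall_fin_succ, IsEmpty.forall_iff, and_true, even_iff_two_dvd] at hv
  simp [Matrix.mulVec, dotProduct, Fin.sum_univ_succ] at hv ⊢
  obtain ⟨a, ha⟩ : ∃ a, v 1 = 2 * a := ⟨v 1 / 2, by omega⟩
  obtain ⟨b, hb⟩ : ∃ b, v 3 = 2 * b := ⟨v 3 / 2, by omega⟩
  obtain ⟨s, hs⟩ : ∃ s, v 0 = v 2 + 2 * s := ⟨(v 0 - v 2) / 2, by omega⟩
  obtain ⟨t, ht⟩ : ∃ t, v 5 = v 2 + v 4 + 2 * t := ⟨(v 5 - v 2 - v 4) / 2, by omega⟩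
  rw [ha, hb, hs, ht]
  intro hQ
  rcases Int.even_or_odd' (v 2) with ⟨k, hk | hk⟩ <;>
    rcases Int.even_or_odd' (v 4) with ⟨l, hl | hl⟩ <;> rw [hk, hl] at hQ <;> ring_nf at hQ <;>
    omega

/-- If `v 4` is even, all coordinates are even and the norm is divisible by 8; if `v 4` is odd, the
norm is 6 modulo 8. -/
theorem cartanE7_norm_ne_two {v : Fin 7 → ℤ} (hv : ∀ i, Even ((CartanMatrix.E₇ *ᵥ v) i)) :
    v ⬝ᵥ CartanMatrix.E₇ *ᵥ v ≠ 2 := by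
  rw [CartanMatrix.E₇] at hv ⊢
  simp only [Fin.forall_fin_succ, IsEmpty.forall_iff, and_true, even_iff_two_dvd] at hv
  simp [Matrix.mulVec, dotProduct, Fin.sum_univ_succ] at hv ⊢
  obtain ⟨a, ha⟩ : ∃ a, v 0 = 2 * a := ⟨v 0 / 2, by omega⟩
  obtain ⟨b, hb⟩ : ∃ b, v 2 = 2 * b := ⟨v 2 / 2, by omega⟩
  obtain ⟨c, hc⟩ : ∃ c, v 3 = 2 * c := ⟨v 3 / 2, by omega⟩
  obtain ⟨d, hd⟩ : ∃ d, v 5 = 2 * d := ⟨v 5 / 2, by omega⟩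
  obtain ⟨s, hs⟩ : ∃ s, v 1 = v 4 + 2 * s := ⟨(v 1 - v 4) / 2, by omega⟩
  obtain ⟨t, ht⟩ : ∃ t, v 6 = v 4 + 2 * t := ⟨(v 6 - v 4) / 2, by omega⟩
  rw [ha, hb, hc, hd, hs, ht]
  intro hQ
  rcases Int.even_or_odd' (v 4) with ⟨k, hk | hk⟩ <;> rw [hk] at hQ <;> ring_nf at hQ <;> omega

theorem cartanE8_norm_ne_two {v : Fin 8 → ℤ} (hv : ∀ i, Even ((CartanMatrix.E₈ *ᵥ v) i)) :
    v ⬝ᵥ CartanMatrix.E₈ *ᵥ v ≠ 2 := by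
  obtain ⟨z, rfl⟩ : ∃ z : Fin 8 → ℤ, v = (2 : ℤ) • z := by
    refine exists_two_smul_of_even fun y => ?_
    rw [formE8_comm, formE8, gramForm, Matrix.toBilin'_apply', dotProduct]
    exact Finset.even_sum _ fun i _ => (hv i).mul_left _
  rw [← Matrix.toBilin'_apply']
  change formE8 _ _ ≠ 2
  rw [map_smul, map_smul, LinearMap.smul_apply, smul_eq_mul, smul_eq_mul]
  omega

theorem isIsometric_formE8_of_eq_top {M : Submodule ℤ (Fin 8 → ℤ)} (hM : ∀ x, x ∈ M) :
    IsIsometric (formE8.restrict M) formE8 :=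
  isIsometric_gramForm_of_basis (by rw [CartanMatrix.E₈_det]; exact one_ne_zero)
    (b := simpleRoot) (fun _ => hM _)
    (fun i j => by simp [formE8, gramForm, simpleRoot])
    fun m _ => ⟨m, eq_sum_simpleRoot m⟩

/-! ### From rootlessness to the four lattices -/

theorem IsOrthogonalRootSet.mono {R S : Finset (Fin 8 → ℤ)} (hR : IsOrthogonalRootSet R)
    (hSR : S ⊆ R) : IsOrthogonalRootSet S :=
  fun r hr s hs => hR r (hSR hr) s (hSR hs)

theorem IsOrthogonalRootSet.formE8_apply {R : Finset (Fin 8 → ℤ)} (hR : IsOrthogonalRootSet R)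
    {n : ℕ} {r : Fin n → Fin 8 → ℤ} (hr : r.Injective) (hrR : Finset.univ.image r = R)
    (i j : Fin n) : formE8 (r i) (r j) = if i = j then 2 else 0 := by
  have hmem (i) : r i ∈ R := hrR ▸ Finset.mem_image_of_mem r (Finset.mem_univ i)
  rw [hR _ (hmem i) _ (hmem j)]
  simp only [hr.eq_iff]

theorem sum_four_of_injective {n : ℕ} {r : Fin n → Fin 8 → ℤ} (hr : r.Injective)
    {i j k l : Fin n} (hij : [i, j, k, l].Nodup) :
    ∑ s ∈ ({r i, r j, r k, r l} : Finset (Fin 8 → ℤ)), s = r i + r j + r k + r l := by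
  simp only [List.nodup_cons, List.mem_cons, List.not_mem_nil, or_false, not_or, List.nodup_nil,
    not_false_eq_true, and_true] at hij
  obtain ⟨⟨h1, h2, h3⟩, ⟨h4, h5⟩, h6⟩ := hij
  rw [Finset.sum_insert, Finset.sum_insert, Finset.sum_insert, Finset.sum_singleton]
  · abel
  all_goals simp [hr.eq_iff, h1, h2, h3, h4, h5, h6]

theorem isIsometric_of_isRootless {h : isometryGroup formE8} (hh : ∀ x, h.1 (h.1 x) = x)
    (hne : h ≠ 1) (hroot : IsRootless h) :
    IsIsometric (formE8.restrict (negEigenlattice h.1)) formD4 ∨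
      IsIsometric (formE8.restrict (negEigenlattice h.1)) formD6 ∨
      IsIsometric (formE8.restrict (negEigenlattice h.1)) formE7 ∨
      IsIsometric (formE8.restrict (negEigenlattice h.1)) formE8 := by
  obtain ⟨R, hR, hhR⟩ := exists_isOrthogonalRootSet (f := (h.1 : (Fin 8 → ℤ) →ₗ[ℤ] (Fin 8 → ℤ)))
    h.2 hh
  replace hhR : ∀ x, h.1 x = x - ∑ r ∈ R, formE8 r x • r := hhR
  have hnonempty : R.Nonempty := by
    rw [Finset.nonempty_iff_ne_empty]
    rintro rfl
    refine hne (Subtype.ext (LinearEquiv.ext fun x => ?_))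
    rw [hhR, Finset.sum_empty, sub_zero]
    rfl
  have hnot (r) (hr : r ∈ R) (x) : ∑ s ∈ R, formE8 s x • s ≠ r := by
    intro hx
    refine hroot r ⟨-x, ?_⟩ (by simpa [IsRoot] using hR r hr r hr)
    change h.1 (-x) - -x = r
    rw [map_neg, hhR, hx]
    abel
  rcases hR.card_le.eq_or_lt with h8 | h8
  -- Each `h x + x` is orthogonal to the eight roots of `R`, hence zero: `h = -1`.
  · refine Or.inr (Or.inr (Or.inr (isIsometric_formE8_of_eq_top fun x => ?_)))
    rw [mem_negEigenlattice, eq_neg_iff_add_eq_zero]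
    refine hR.eq_zero_of_card_eq h8 fun r hr => ?_
    rw [map_add, hhR, map_sub, hR.formE8_sum hr]
    ring
  have hindex {n : ℕ} {r : Fin n → Fin 8 → ℤ} (hr : r.Injective)
      (hrR : Finset.univ.image r = R) (x) : h.1 x = x - ∑ i, formE8 (r i) x • r i := by
    rw [hhR, ← hrR, Finset.sum_image fun _ _ _ _ hij => hr hij]
  rcases doublyEven_code_cases (R := R)
    (H := fun S => S ⊆ R ∧ ∃ z : Fin 8 → ℤ, ∑ s ∈ S, s = (2 : ℤ) • z)
    (fun S hS => hS.1)
    (fun S hS => hS.2.elim fun z hz => (hR.mono hS.1).four_dvd_card hz)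
    (fun S T hS hT => ⟨(Finset.symmDiff_subset_union).trans (Finset.union_subset hS.1 hT.1),
      exists_two_smul_symmDiff hS.2 hT.2⟩)
    (fun r hr => by
      obtain ⟨S, hSR, hrS, hS⟩ := hR.exists_half_sum hr (hnot r hr)
      exact ⟨S, ⟨hSR, hS⟩, hrS⟩)
    hnonempty (Nat.le_of_lt_succ h8) with
    ⟨r, hr, hrR, -, u, hu⟩ | ⟨r, hr, hrR, ⟨-, u, hu⟩, -, v, hv⟩ |
    ⟨r, hr, hrR, ⟨-, u, hu⟩, ⟨-, v, hv⟩, -, w, hw⟩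
  · rw [sum_four_of_injective hr (by decide)] at hu
    exact Or.inl (isIsometric_formD4 (hR.formE8_apply hr hrR) (hindex hr hrR) hu)
  · rw [sum_four_of_injective hr (by decide)] at hu hv
    exact Or.inr (Or.inl (isIsometric_formD6 (hR.formE8_apply hr hrR) (hindex hr hrR) hu hv))
  · rw [sum_four_of_injective hr (by decide)] at hu hv hw
    exact Or.inr (Or.inr (Or.inl
      (isIsometric_formE7 (hR.formE8_apply hr hrR) (hindex hr hrR) hu hv hw)))

end IntegralLattice

theorem theorem4p9 (h : IntegralLattice.isometryGroup IntegralLattice.formE8)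
    (hord : orderOf h = 2) :
    IntegralLattice.IsRootless h ↔
      (IntegralLattice.IsIsometric
          (IntegralLattice.formE8.restrict (IntegralLattice.negEigenlattice h.1))
          IntegralLattice.formD4 ∨
        IntegralLattice.IsIsometric
          (IntegralLattice.formE8.restrict (IntegralLattice.negEigenlattice h.1))
          IntegralLattice.formD6 ∨
        IntegralLattice.IsIsometric
          (IntegralLattice.formE8.restrict (IntegralLattice.negEigenlattice h.1))
          IntegralLattice.formE7 ∨
        IntegralLattice.IsIsometric
          (IntegralLattice.formE8.restrict (IntegralLattice.negEigenlattice h.1))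
          IntegralLattice.formE8) := by
  have hsq : h * h = 1 := by rw [← pow_two, ← hord, pow_orderOf_eq_one]
  have hh (x) : h.1 (h.1 x) = x :=
    LinearEquiv.congr_fun (congrArg Subtype.val hsq) x
  have hne : h ≠ 1 := by
    rintro rfl
    simp at hord
  refine ⟨IntegralLattice.isIsometric_of_isRootless hh hne, ?_⟩
  rintro (hM | hM | hM | hM)
  · exact IntegralLattice.isRootless_of_isIsometric_gramForm hh
      (fun _ => IntegralLattice.cartanD4_norm_ne_two) hM
  · exact IntegralLattice.isRootless_of_isIsometric_gramForm hh
      (fun _ => IntegralLattice.cartanD6_norm_ne_two) hM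
  · exact IntegralLattice.isRootless_of_isIsometric_gramForm hh
      (fun _ => IntegralLattice.cartanE7_norm_ne_two) hM
  · exact IntegralLattice.isRootless_of_isIsometric_gramForm hh
      (fun _ => IntegralLattice.cartanE8_norm_ne_two) hM
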